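/- Let $K$ be an algebraically closed field and let $A$ be a finite-dimensional hereditary $K$-algebra. All modules are finitely generated right $A$-modules. A module $T$ is a *tilting module* if $\operatorname{pd} T\le 1$, $\operatorname{Ext}^1_A(T,T)=0$, and there is a short exact sequence $0\to A_A\to T'\to T''\to 0$ with $T',T''\in\operatorname{add}T$, where $\operatorname{add} T$ consists of the finite direct sums of direct summands of $T$. It is *basic* if no indecomposable direct summand occurs more than once in $T$ and the number of isomorphism classes of indecomposable direct summands of $T$ is the rank of the Grothendieck group $K_0(A)$. A *stratifying system* of size $t$ is a sequence $(X_1,\dots,X_t)$ of indecomposable modules such that $\operatorname{Hom}_A(X_j,X_i)=0$ for $j>i$ and $\operatorname{Ext}^1_A(X_j,X_i)=0$ for $j\ge i$; it is *complete* if $t$ is the number of isomorphism classes of simple $A$-modules. **Proposition.** Let $T$ be a basic tilting $A$-module. Then $T$ is a direct sum of finitely many indecomposable modules, and for every such decomposition $T\cong\bigoplus_{i=1}^n T_i$ the summands can be renumbered so that $(T_1,\dots,T_n)$ is a complete stratifying system. -/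

import Mathlib

open CategoryTheory CategoryTheory.Limits

universe u

/-- Right modules over the ring `A`, that is, left modules over the opposite ring. -/
abbrev RightMod (A : Type u) [Ring A] : Type (u + 1) := ModuleCat.{u} Aᵐᵒᵖ

namespace RightMod

/-- `A` is (right) hereditary: every right ideal of `A` is a projective right module. -/
def IsHereditary (A : Type u) [Ring A] : Prop :=
  ∀ I : Submodule Aᵐᵒᵖ A, Module.Projective Aᵐᵒᵖ I

variable {A : Type u} [Ring A]

/-- `M` is (isomorphic to) a direct summand of `T`. -/
def IsSummand (M T : RightMod A) : Prop :=
  ∃ N : RightMod A, Nonempty (T ≅ M ⊞ N)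

/-- `M` lies in `add T`: it is a finite direct sum of direct summands of `T`. -/
def InAdd (T M : RightMod A) : Prop :=
  ∃ (m : ℕ) (N : Fin m → RightMod A), (∀ i, IsSummand (N i) T) ∧ Nonempty (M ≅ ⨁ N)

/-- `Ext¹(M, N) = 0`. -/
def ExtOneVanishes (M N : RightMod A) : Prop :=
  Subsingleton (Abelian.Ext.{u} M N 1)

/-- The finitely generated right `A`-module `T` is a tilting module. -/
structure IsTilting (T : RightMod A) : Prop where
  finite : Module.Finite Aᵐᵒᵖ T
  projDim_le_one : HasProjectiveDimensionLE T 1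
  ext_self : ExtOneVanishes T T
  exists_coresolution : ∃ S : ShortComplex (RightMod A), S.ShortExact ∧
    Nonempty (S.X₁ ≅ ModuleCat.of Aᵐᵒᵖ A) ∧ InAdd T S.X₂ ∧ InAdd T S.X₃

variable (A) in
/-- The objects of `mod A`: the finitely generated right `A`-modules. -/
abbrev FGMod : Type (u + 1) := {M : RightMod A // Module.Finite Aᵐᵒᵖ M}

variable (A) in
/-- The relations `[M₂] - [M₁] - [M₃]`, one for each short exact sequence
`0 → M₁ → M₂ → M₃ → 0` of finitely generated right `A`-modules. -/
def grothendieckRelations : Set (FreeAbelianGroup (FGMod A)) :=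
  {x | ∃ (M₁ M₂ M₃ : FGMod A) (f : M₁.1 ⟶ M₂.1) (g : M₂.1 ⟶ M₃.1) (w : f ≫ g = 0),
    (ShortComplex.mk f g w).ShortExact ∧
    x = FreeAbelianGroup.of M₂ - FreeAbelianGroup.of M₁ - FreeAbelianGroup.of M₃}

variable (A) in
/-- The Grothendieck group `K₀(A)` of the category of finitely generated right `A`-modules. -/
abbrev GrothendieckGroup : Type (u + 1) :=
  FreeAbelianGroup (FGMod A) ⧸ AddSubgroup.closure (grothendieckRelations A)

/-- The set of isomorphism classes of the right `A`-modules that satisfy `P`. -/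
def isoClasses (P : RightMod A → Prop) : Set (Quotient (isIsomorphicSetoid (RightMod A))) :=
  {c | ∃ M : RightMod A, P M ∧ c = Quotient.mk _ M}

/-- `T` is a basic tilting module: a tilting module in which no indecomposable summand is
repeated, and whose indecomposable summands form exactly `rank K₀(A)` isomorphism classes. -/
structure IsBasicTilting (T : RightMod A) : Prop where
  isTilting : IsTilting T
  multiplicity_free : ∀ M : RightMod A, Indecomposable M → ¬ IsSummand (M ⊞ M) T
  card_summands : (isoClasses fun M : RightMod A => Indecomposable M ∧ IsSummand M T).encard =
    (Module.finrank ℤ (GrothendieckGroup A) : ℕ∞)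

/-- The finite sequence `X` of finitely generated right `A`-modules is a stratifying system. -/
structure IsStratifyingSystem {t : ℕ} (X : Fin t → RightMod A) : Prop where
  finite : ∀ i, Module.Finite Aᵐᵒᵖ (X i)
  indecomposable : ∀ i, Indecomposable (X i)
  hom_eq_zero : ∀ i j, i < j → ∀ f : X j ⟶ X i, f = 0
  ext_vanishes : ∀ i j, i ≤ j → ExtOneVanishes (X j) (X i)

/-- A stratifying system is complete when its size is the number of isomorphism classes of
simple right `A`-modules. -/
structure IsCompleteStratifyingSystem {t : ℕ} (X : Fin t → RightMod A) : Prop where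
  isStratifyingSystem : IsStratifyingSystem X
  size_eq : (isoClasses fun S : RightMod A => IsSimpleModule Aᵐᵒᵖ S).encard = (t : ℕ∞)

end RightMod

/-! The indecomposable summands of `T` are pairwise non-isomorphic because `T` is multiplicity-free,
and all `Ext¹` groups between them vanish because they are retracts of `T`. Only the `Hom` condition
depends on the order. By the Happel–Ringel lemma (`injective_or_surjective_of_extensionsSplit`), a
nonzero map between summands is injective or surjective. A proper surjection followed by a proper
injection would compose to a nonzero map that is neither, so along a path of nonzero maps between
distinct summands no injection follows a surjection. A cycle would thus consist of proper injections
only or of proper surjections only, which lengths forbid; `exists_perm_hom_eq_zero` turns this into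
an ordering. For completeness, the number of summands is the rank of `K₀(A)` by hypothesis, and this
rank is the number of simples (`encard_isoClasses_isSimpleModule`): composition series show that the
simple classes span, and the additive functions `M ↦ dim eM`, for idempotents `e` separating the
simples, show independence. -/

/-! ### Indecomposable modules and Fitting's lemma -/

section ModuleTheory

variable {R : Type*} [Ring R]

/-- A nonzero module without nontrivial direct sum decompositions. -/
def IsIndecomposableModule (R M : Type*) [Ring R] [AddCommGroup M] [Module R M] : Prop :=
  Nontrivial M ∧ ∀ p q : Submodule R M, IsCompl p q → p = ⊥ ∨ q = ⊥

namespace IsIndecomposableModule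

variable {M N : Type*} [AddCommGroup M] [Module R M] [AddCommGroup N] [Module R N]

/-- Fitting's lemma. -/
theorem isUnit_or_isNilpotent [IsArtinian R M] [IsNoetherian R M]
    (hM : IsIndecomposableModule R M) (f : Module.End R M) : IsUnit f ∨ IsNilpotent f := by
  obtain ⟨n, hn⟩ := Filter.eventually_atTop.mp f.eventually_isCompl_ker_pow_range_pow
  -- A positive exponent is needed: `f ^ 0` is a unit for every `f`.
  have h := hn (n + 1) (by omega)
  rcases hM.2 _ _ h with h0 | h0
  · left
    rw [h0] at h
    have h1 : LinearMap.range (f ^ (n + 1)) = ⊤ := by simpa using h.sup_eq_top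
    have hu : IsUnit (f ^ (n + 1)) :=
      (Module.End.isUnit_iff _).2 ⟨LinearMap.ker_eq_bot.1 h0, LinearMap.range_eq_top.1 h1⟩
    exact (isUnit_pow_succ_iff).1 hu
  · exact Or.inr ⟨n + 1, LinearMap.range_eq_bot.1 h0⟩

/-- Locality of the endomorphism ring: normalise the sum to `1`; by Fitting, a summand that is not a
unit is nilpotent, and `1` minus a nilpotent is a unit. -/
theorem isUnit_or_isUnit_of_add [IsArtinian R M] [IsNoetherian R M]
    (hM : IsIndecomposableModule R M) {f g : Module.End R M} (h : IsUnit (f + g)) :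
    IsUnit f ∨ IsUnit g := by
  obtain ⟨w, hw⟩ := h
  have h1 : (↑w⁻¹ * f : Module.End R M) + ↑w⁻¹ * g = 1 := by
    rw [← mul_add, ← hw, Units.inv_mul]
  rcases hM.isUnit_or_isNilpotent (↑w⁻¹ * f) with h2 | h2
  · exact Or.inl ((Units.isUnit_units_mul _ _).1 h2)
  · right
    rw [← Units.isUnit_units_mul w⁻¹, ← sub_eq_of_eq_add' h1.symm]
    exact h2.isUnit_one_sub

theorem exists_isUnit_of_sum [IsArtinian R M] [IsNoetherian R M]
    (hM : IsIndecomposableModule R M) {ι : Type*} (s : Finset ι) (f : ι → Module.End R M)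
    (h : IsUnit (∑ i ∈ s, f i)) : ∃ i ∈ s, IsUnit (f i) := by
  classical
  induction s using Finset.induction_on with
  | empty =>
    have := hM.1
    simp at h
  | insert a s ha ih =>
    rw [Finset.sum_insert ha] at h
    rcases hM.isUnit_or_isUnit_of_add h with h | h
    · exact ⟨a, by simp, h⟩
    · obtain ⟨i, hi, h⟩ := ih h
      exact ⟨i, by simp [hi], h⟩

/-- A split monomorphism from a nonzero module to an indecomposable one is bijective. -/
theorem bijective_of_comp_bijective [Nontrivial M] (hN : IsIndecomposableModule R N)
    {f : M →ₗ[R] N} {g : N →ₗ[R] M} (h : Function.Bijective (g ∘ₗ f)) : Function.Bijective f := by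
  have hf : Function.Injective f := (by simpa using h.1 : Function.Injective (g ∘ f)).of_comp
  have hc : IsCompl (LinearMap.range f) (LinearMap.ker g) := by
    refine IsCompl.of_eq ?_ ?_
    · rw [eq_bot_iff]
      rintro _ ⟨⟨x, rfl⟩, hx⟩
      have : (g ∘ₗ f) x = (g ∘ₗ f) 0 := by simpa using hx
      simp [h.1 this]
    · rw [eq_top_iff]
      intro y _
      obtain ⟨x, hx⟩ := h.2 (g y)
      exact Submodule.mem_sup.2 ⟨f x, ⟨x, rfl⟩, y - f x, by simpa [sub_eq_zero] using hx.symm,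
        by simp⟩
  rcases hN.2 _ _ hc with h0 | h0
  · exfalso
    obtain ⟨x, hx⟩ := exists_ne (0 : M)
    rw [LinearMap.range_eq_bot] at h0
    exact hx (hf (by simp [h0]))
  · rw [h0] at hc
    exact ⟨hf, LinearMap.range_eq_top.1 (by simpa using hc.sup_eq_top)⟩

end IsIndecomposableModule

/-! ### Modules with projective submodules -/

/-- A module all of whose submodules are projective. -/
def SubmodulesProjective (R M : Type*) [Ring R] [AddCommGroup M] [Module R M] : Prop :=
  ∀ N : Submodule R M, Module.Projective R N

namespace SubmodulesProjective

variable {M N : Type*} [AddCommGroup M] [Module R M] [AddCommGroup N] [Module R N]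

theorem of_equiv (h : SubmodulesProjective R M) (e : M ≃ₗ[R] N) : SubmodulesProjective R N := by
  intro L
  have := h (L.map (e.symm : N →ₗ[R] M))
  exact Module.Projective.of_equiv (e.symm.submoduleMap L).symm

/-- The projection of `L` to `N` has projective image, so it splits off its kernel, which embeds in
`M`. -/
theorem prod (hM : SubmodulesProjective R M) (hN : SubmodulesProjective R N) :
    SubmodulesProjective R (M × N) := by
  intro L
  let π : L →ₗ[R] N := LinearMap.snd R M N ∘ₗ L.subtype
  have := hN (LinearMap.range π)
  obtain ⟨s, hs⟩ := LinearMap.exists_rightInverse_of_surjective π.rangeRestrict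
    π.range_rangeRestrict
  let κ : LinearMap.ker π →ₗ[R] M := LinearMap.fst R M N ∘ₗ L.subtype ∘ₗ (LinearMap.ker π).subtype
  have hκ : Function.Injective κ := by
    rintro ⟨⟨⟨a, b⟩, h1⟩, h2⟩ ⟨⟨⟨a', b'⟩, h1'⟩, h2'⟩ h
    have e1 : b = 0 := h2
    have e2 : b' = 0 := h2'
    have e3 : a = a' := h
    subst e1 e2 e3
    rfl
  have := hM (LinearMap.range κ)
  have hker : Module.Projective R (LinearMap.ker π) :=
    Module.Projective.of_equiv (LinearEquiv.ofInjective κ hκ).symm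
  have hex : Function.Exact (LinearMap.ker π).subtype π.rangeRestrict := by
    rw [LinearMap.exact_iff]
    simp
  exact Module.Projective.of_equiv
    (hex.splitSurjectiveEquiv (Submodule.injective_subtype _) ⟨s, hs⟩).1.symm

theorem pi_fin (h : SubmodulesProjective R M) (n : ℕ) : SubmodulesProjective R (Fin n → M) := by
  induction n with
  | zero =>
    intro L
    have : Subsingleton L := inferInstance
    infer_instance
  | succ n ih =>
    exact (h.prod ih).of_equiv (Fin.consLinearEquiv R fun _ => M)

end SubmodulesProjective

/-! ### The Happel–Ringel lemma -/

/-- Every extension of `Y` by `X` splits. -/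
def ExtensionsSplit.{v} (R : Type*) (Y X : Type v) [Ring R] [AddCommGroup X] [Module R X]
    [AddCommGroup Y] [Module R Y] : Prop :=
  ∀ (E : Type v) [AddCommGroup E] [Module R E] (i : X →ₗ[R] E) (p : E →ₗ[R] Y),
    Function.Injective i → Function.Surjective p → Function.Exact i p →
      ∃ r : E →ₗ[R] X, r ∘ₗ i = LinearMap.id

/-- The Happel–Ringel lemma. -/
theorem injective_or_surjective_of_extensionsSplit.{v} {X Y P : Type v} [AddCommGroup X]
    [Module R X] [AddCommGroup Y] [Module R Y] [AddCommGroup P] [Module R P]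
    [IsArtinian R X] [IsNoetherian R X]
    (hX : IsIndecomposableModule R X) (hY : IsIndecomposableModule R Y)
    (hP : SubmodulesProjective R P) (p : P →ₗ[R] Y) (hp : Function.Surjective p)
    (hext : ExtensionsSplit R Y X) (f : X →ₗ[R] Y) (hf : f ≠ 0) :
    Function.Injective f ∨ Function.Surjective f := by
  let I := LinearMap.range f
  let Ω : Submodule R P := I.comap p
  have := hP Ω
  -- The only use of heredity: `Ω = p⁻¹(I)` is projective, so `p : Ω → I` lifts through `X → I`.
  obtain ⟨t, ht⟩ := Module.projective_lifting_property f.rangeRestrict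
    (p.restrict (p := Ω) (q := I) fun x hx => hx) f.surjective_rangeRestrict
  have hft : ∀ w : Ω, f (t w) = p w := fun w => congrArg Subtype.val (LinearMap.congr_fun ht w)
  -- `Z` is the pushout of `Ω ⊆ P` along `t`; it gives an exact sequence `0 → X → Z × I → Y → 0`,
  -- which splits by `hext`.
  let D : Submodule R (X × P) := LinearMap.range (t.prod (-Ω.subtype))
  let Z := (X × P) ⧸ D
  let a : X →ₗ[R] Z := D.mkQ ∘ₗ LinearMap.inl R X P
  let b : Z →ₗ[R] Y := D.liftQ (f.coprod p) (by
    rintro _ ⟨w, rfl⟩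
    simp [hft])
  have hb : ∀ x q, b (D.mkQ (x, q)) = f x + p q := fun x q => rfl
  let i : X →ₗ[R] Z × I := a.prod (-f.rangeRestrict)
  let π : Z × I →ₗ[R] Y := b.coprod I.subtype
  have ha : Function.Injective a := by
    rw [← LinearMap.ker_eq_bot, eq_bot_iff]
    intro x hx
    obtain ⟨w, hw⟩ : (x, (0 : P)) ∈ D := (Submodule.Quotient.mk_eq_zero D).1 hx
    have hw1 : t w = x := congrArg Prod.fst hw
    have hw2 : -(w : P) = 0 := congrArg Prod.snd hw
    have : w = 0 := Subtype.ext (neg_eq_zero.1 hw2)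
    simp [← hw1, this]
  have hi : Function.Injective i := fun x y h => ha (congrArg Prod.fst h)
  have hπ : Function.Surjective π := fun y => by
    obtain ⟨q, rfl⟩ := hp y
    exact ⟨(D.mkQ (0, q), 0), by
      change f 0 + p q + 0 = p q
      simp⟩
  have hex : Function.Exact i π := by
    rw [LinearMap.exact_iff]
    refine le_antisymm ?_ ?_
    · rintro ⟨z, j⟩ hz
      obtain ⟨⟨x, q⟩, rfl⟩ := D.mkQ_surjective z
      have hz' : f x + p q + j = 0 := hz
      have hq : q ∈ Ω := by
        have : p q = -(f x) - j := by
          rw [eq_sub_iff_add_eq, eq_neg_iff_add_eq_zero, ← hz']; abel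
        change p q ∈ I
        rw [this]
        exact I.sub_mem (I.neg_mem ⟨x, rfl⟩) j.2
      refine ⟨x + t ⟨q, hq⟩, ?_⟩
      refine Prod.ext ?_ ?_
      · change D.mkQ _ = D.mkQ _
        rw [← sub_eq_zero, ← map_sub, D.mkQ_apply, Submodule.Quotient.mk_eq_zero]
        exact ⟨⟨q, hq⟩, by simp⟩
      · apply Subtype.ext
        change -f (x + t ⟨q, hq⟩) = j
        rw [map_add, hft, neg_eq_iff_add_eq_zero]
        exact hz'
    · rintro _ ⟨x, rfl⟩
      change f x + p 0 + -f x = 0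
      simp
  obtain ⟨r, hr⟩ := hext (Z × I) i π hi hπ hex
  -- The retraction writes the identity of `X` as a map through `Z` plus a map through `I`; one is a
  -- unit. The first case makes `I` a nonzero summand of `Y`, hence all of `Y`; the second makes `f`
  -- injective.
  have hsum : (r ∘ₗ LinearMap.inl R Z I ∘ₗ a) +
      -(r ∘ₗ LinearMap.inr R Z I ∘ₗ f.rangeRestrict) = (1 : Module.End R X) := by
    ext x
    have := LinearMap.congr_fun hr x
    have hix : i x = (a x, 0) + -(0, f.rangeRestrict x) := by
      ext <;> simp [i]
    rw [LinearMap.comp_apply, hix, map_add, map_neg] at this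
    exact this
  rcases hX.isUnit_or_isUnit_of_add (by rw [hsum]; exact isUnit_one) with h | h
  · right
    have hu := (Module.End.isUnit_iff _).1 h
    obtain ⟨v, hv⟩ := h
    -- a retraction of `a`
    let r' : Z →ₗ[R] X := (↑v⁻¹ : Module.End R X) ∘ₗ r ∘ₗ LinearMap.inl R Z I
    have hr' : ∀ x, r' (a x) = x := fun x => by
      have : (↑v⁻¹ * ↑v : Module.End R X) x = x := by simp
      rw [hv] at this
      exact this
    -- it induces a retraction of the inclusion of `I` in `Y`
    let c : P →ₗ[R] I := f.rangeRestrict ∘ₗ r' ∘ₗ D.mkQ ∘ₗ LinearMap.inr R X P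
    have hc : ∀ w : Ω, (c w : Y) = p w := fun w => by
      have : D.mkQ (0, (w : P)) = a (t w) := by
        change _ = D.mkQ (t w, 0)
        rw [eq_comm, ← sub_eq_zero, ← map_sub, D.mkQ_apply, Submodule.Quotient.mk_eq_zero]
        exact ⟨w, by simp⟩
      change f (r' (D.mkQ (0, (w : P)))) = _
      rw [this, hr', hft]
    have hker : LinearMap.ker p ≤ LinearMap.ker c := fun q hq => by
      have hq' : p q = 0 := hq
      have hqΩ : q ∈ Ω := by change p q ∈ I; rw [hq']; exact I.zero_mem
      exact Subtype.ext ((hc ⟨q, hqΩ⟩).trans hq')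
    let d : Y →ₗ[R] I := (LinearMap.ker p).liftQ c hker ∘ₗ
      (p.quotKerEquivOfSurjective hp).symm.toLinearMap
    have hd : ∀ q, d (p q) = c q := fun q => by
      have : (p.quotKerEquivOfSurjective hp).symm (p q) = (LinearMap.ker p).mkQ q := by
        rw [LinearEquiv.symm_apply_eq]; rfl
      simp [d, this]
    have hdI : d ∘ₗ I.subtype = LinearMap.id := by
      ext ⟨y, hy⟩
      obtain ⟨q, rfl⟩ := hp y
      change (d (p q) : Y) = _
      rw [hd]
      exact hc ⟨q, hy⟩
    have : Nontrivial I := by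
      rw [Submodule.nontrivial_iff_ne_bot]
      exact fun h => hf (LinearMap.range_eq_bot.1 h)
    have hbij := hY.bijective_of_comp_bijective (f := I.subtype) (g := d)
      (by rw [hdI]; exact Function.bijective_id)
    intro y
    obtain ⟨⟨_, x, rfl⟩, hx⟩ := hbij.2 y
    exact ⟨x, hx⟩
  · left
    have hu := ((Module.End.isUnit_iff _).1 h).1
    intro x y hxy
    apply hu
    have : f.rangeRestrict x = f.rangeRestrict y := Subtype.ext hxy
    simp [this]

end ModuleTheory

/-! ### Length as a natural number -/

section ModuleLength

variable (R : Type*) [Ring R]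

/-- The length of a module as a natural number. -/
noncomputable def moduleLength (M : Type*) [AddCommGroup M] [Module R M] : ℕ :=
  (Module.length R M).toNat

variable {M N : Type*} [AddCommGroup M] [Module R M] [AddCommGroup N] [Module R N]

theorem LinearEquiv.moduleLength_eq (e : M ≃ₗ[R] N) : moduleLength R M = moduleLength R N := by
  rw [moduleLength, e.length_eq, moduleLength]

variable [IsArtinian R M] [IsNoetherian R M] [IsArtinian R N] [IsNoetherian R N]

theorem moduleLength_prod : moduleLength R (M × N) = moduleLength R M + moduleLength R N := by
  rw [moduleLength, Module.length_prod, ENat.toNat_add Module.length_ne_top Module.length_ne_top]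
  rfl

theorem moduleLength_pos [Nontrivial M] : 0 < moduleLength R M :=
  Nat.pos_of_ne_zero fun h => by
    rcases ENat.toNat_eq_zero.1 h with h | h
    · exact (Module.length_pos (R := R) (M := M)).ne' h
    · exact Module.length_ne_top h

variable {R}

theorem moduleLength_lt_of_injective {f : M →ₗ[R] N} (hf : Function.Injective f)
    (hf' : ¬ Function.Surjective f) : moduleLength R M < moduleLength R N := by
  rw [moduleLength, (LinearEquiv.ofInjective f hf).length_eq, moduleLength,
    ← Nat.cast_lt (α := ℕ∞), ENat.natCast_toNat Module.length_ne_top,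
    ENat.natCast_toNat Module.length_ne_top]
  exact Submodule.length_lt fun h => hf' (LinearMap.range_eq_top.1 h)

theorem moduleLength_lt_of_surjective {f : M →ₗ[R] N} (hf : Function.Surjective f)
    (hf' : ¬ Function.Injective f) : moduleLength R N < moduleLength R M := by
  have : Nontrivial (LinearMap.ker f) := by
    rwa [Submodule.nontrivial_iff_ne_bot, Ne, LinearMap.ker_eq_bot]
  have h := Module.length_eq_add_of_exact (LinearMap.ker f).subtype f
    (Submodule.subtype_injective _) hf (LinearMap.exact_subtype_ker_map f)
  have h1 : moduleLength R M = moduleLength R (LinearMap.ker f) + moduleLength R N := by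
    rw [moduleLength, h, ENat.toNat_add Module.length_ne_top Module.length_ne_top]
    rfl
  have := moduleLength_pos R (M := LinearMap.ker f)
  omega

end ModuleLength

/-! ### From categorical to module-theoretic notions -/

namespace ModuleCat

variable {R : Type u} [Ring R]

theorem isIndecomposableModule {M : ModuleCat.{u} R} (h : Indecomposable M) :
    IsIndecomposableModule R M := by
  refine ⟨?_, fun p q hpq => ?_⟩
  · rw [← not_subsingleton_iff_nontrivial]
    exact fun hs => h.1 (isZero_of_subsingleton M)
  · rcases h.2 (of R p) (of R q) ((Submodule.prodEquivOfIsCompl p q hpq).symm.toModuleIso ≪≫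
      (biprodIsoProd (of R p) (of R q)).symm) with h0 | h0
    · have := subsingleton_of_isZero h0
      exact Or.inl ((Submodule.subsingleton_iff_eq_bot).1 this)
    · have := subsingleton_of_isZero h0
      exact Or.inr ((Submodule.subsingleton_iff_eq_bot).1 this)

/-- The obstruction to extending the identity of `X` along `i` lies in `Ext¹(Y, X)`. -/
theorem extensionsSplit {X Y : ModuleCat.{u} R} (h : Subsingleton (Abelian.Ext.{u} Y X 1)) :
    ExtensionsSplit R Y X := by
  intro E _ _ i p hi hp hex
  have hS := shortComplex_shortExact
    (.mk (ofHom i) (ofHom p) (by ext x; exact hex.apply_apply_eq_zero x)) hex hi hp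
  obtain ⟨r, hr⟩ := Abelian.Ext.contravariant_sequence_exact₁ hS X (Abelian.Ext.mk₀ (𝟙 X))
    (n₁ := 1) rfl (h.elim _ _)
  refine ⟨(Abelian.Ext.homEquiv₀ r).hom, ?_⟩
  rw [← Abelian.Ext.mk₀_homEquiv₀_apply r, Abelian.Ext.mk₀_comp_mk₀] at hr
  exact congrArg Hom.hom ((Abelian.Ext.mk₀_bijective _ _).1 hr)

end ModuleCat

namespace CategoryTheory.Abelian.Ext

variable {C : Type*} [Category C] [Abelian C] [HasExt.{u} C]

/-- Each class is recovered from its image in `Ext(T, T)` by the retractions. -/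
theorem subsingleton_of_retract {T X Y : C} {n : ℕ} (hT : Subsingleton (Ext.{u} T T n))
    (rX : Retract X T) (rY : Retract Y T) : Subsingleton (Ext.{u} X Y n) := by
  have key : ∀ x : Ext.{u} X Y n, x = (mk₀ rX.i).comp
      (((mk₀ rX.r).comp (x.comp (mk₀ rY.i) (add_zero n)) (zero_add n)).comp
        (mk₀ rY.r) (add_zero n)) (zero_add n) := fun x => by
    rw [comp_assoc_of_third_deg_zero, comp_assoc_of_third_deg_zero, mk₀_comp_mk₀,
      mk₀_comp_mk₀_assoc, rX.retract, rY.retract, mk₀_id_comp, comp_mk₀_id]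
  refine ⟨fun x y => ?_⟩
  rw [key x, key y, hT.elim ((mk₀ rX.r).comp (x.comp (mk₀ rY.i) _) _)
    ((mk₀ rX.r).comp (y.comp (mk₀ rY.i) _) _)]

end CategoryTheory.Abelian.Ext

/-! ### Decompositions into indecomposables -/

namespace ModuleCat

variable {R : Type u} [Ring R]

theorem finite_of_retract {M T : ModuleCat.{u} R} (r : Retract M T) [Module.Finite R T] :
    Module.Finite R M :=
  Module.Finite.of_surjective r.r.hom fun x => ⟨r.i.hom x, by
    rw [← LinearMap.comp_apply, ← hom_comp, r.retract]; rfl⟩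

/-- A retract of a module is a direct summand. -/
theorem exists_iso_biprod_of_retract {M T : ModuleCat.{u} R} (r : Retract M T) :
    ∃ N : ModuleCat.{u} R, Nonempty (T ≅ M ⊞ N) := by
  have hex : Function.Exact (LinearMap.ker r.r.hom).subtype r.r.hom := by
    rw [LinearMap.exact_iff]
    simp
  let e := (hex.splitSurjectiveEquiv (Submodule.injective_subtype _)
    ⟨r.i.hom, by rw [← hom_comp, r.retract]; rfl⟩).1
  exact ⟨of R (LinearMap.ker r.r.hom), ⟨(e.trans (LinearEquiv.prodComm R _ _)).toModuleIso ≪≫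
    (biprodIsoProd M (of R (LinearMap.ker r.r.hom))).symm⟩⟩

/-- The inclusion and the projection of a summand of a biproduct. -/
noncomputable def retractOfIsoBiproduct {T : ModuleCat.{u} R} {n : ℕ} {X : Fin n → ModuleCat.{u} R}
    (e : T ≅ ⨁ X) (i : Fin n) : Retract (X i) T where
  i := biproduct.ι X i ≫ e.inv
  r := e.hom ≫ biproduct.π X i

/-- Krull–Schmidt: the identity of `M` is a sum of maps through the `X i`, so by locality one of
these is a unit, which makes `M` a nonzero summand of the indecomposable `X i`. -/
theorem exists_iso_of_retract_biproduct [IsArtinianRing R] {M T : ModuleCat.{u} R} {n : ℕ}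
    {X : Fin n → ModuleCat.{u} R} (hX : ∀ i, Indecomposable (X i)) (hM : Indecomposable M)
    [Module.Finite R T] (e : T ≅ ⨁ X) (r : Retract M T) : ∃ i, Nonempty (M ≅ X i) := by
  have := finite_of_retract r
  let f (i : Fin n) : M ⟶ X i := r.i ≫ e.hom ≫ biproduct.π X i
  let g (i : Fin n) : X i ⟶ M := biproduct.ι X i ≫ e.inv ≫ r.r
  have hsum : ∑ i, f i ≫ g i = 𝟙 M := by
    have h1 : ∀ i, f i ≫ g i =
        (r.i ≫ e.hom) ≫ (biproduct.π X i ≫ biproduct.ι X i) ≫ (e.inv ≫ r.r) := fun i => by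
      simp [f, g]
    simp_rw [h1]
    rw [← Preadditive.comp_sum, ← Preadditive.sum_comp, biproduct.total]
    simp
  have hsum' : ∑ i, ((g i).hom ∘ₗ (f i).hom : Module.End R M) = 1 := by
    have := congrArg Hom.hom hsum
    rw [hom_sum] at this
    exact this
  have hMi := isIndecomposableModule hM
  obtain ⟨i, -, hi⟩ := hMi.exists_isUnit_of_sum Finset.univ _
    (by rw [hsum']; exact isUnit_one)
  have := hMi.1
  have hb := (isIndecomposableModule (hX i)).bijective_of_comp_bijective
    ((Module.End.isUnit_iff _).1 hi)
  exact ⟨i, ⟨(LinearEquiv.ofBijective (f i).hom hb).toModuleIso⟩⟩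

theorem exists_iso_biproduct_of_iso_biprod {T Y Z : ModuleCat.{u} R} (e : T ≅ Y ⊞ Z) {m n : ℕ}
    {X : Fin m → ModuleCat.{u} R} {X' : Fin n → ModuleCat.{u} R} (f : Y ≅ ⨁ X) (g : Z ≅ ⨁ X') :
    Nonempty (T ≅ ⨁ fun i => Sum.elim X X' (finSumFinEquiv.symm i)) := by
  let A : Fin m ⊕ Fin n → ModuleCat.{u} R := Sum.elim X X'
  let e1 : of R (∀ s, A s) ≅ of R ((∀ i, X i) × (∀ i, X' i)) :=
    (LinearEquiv.sumPiEquivProdPi R (Fin m) (Fin n) (fun s => A s)).toModuleIso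
  let e2 : Y ⊞ Z ≅ of R ((∀ i, X i) × (∀ i, X' i)) :=
    biprod.mapIso (f ≪≫ biproductIsoPi X) (g ≪≫ biproductIsoPi X') ≪≫ biprodIsoProd _ _
  exact ⟨e ≪≫ e2 ≪≫ e1.symm ≪≫ (biproductIsoPi A).symm ≪≫
    (biproduct.reindex finSumFinEquiv.symm A).symm⟩

theorem exists_iso_biproduct_indecomposable [IsArtinianRing R] (T : ModuleCat.{u} R)
    [Module.Finite R T] : ∃ (n : ℕ) (X : Fin n → ModuleCat.{u} R),
      (∀ i, Indecomposable (X i)) ∧ Nonempty (T ≅ ⨁ X) := by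
  induction hd : moduleLength R T using Nat.strong_induction_on generalizing T with
  | _ d ih =>
  subst hd
  by_cases h0 : IsZero T
  · exact ⟨0, Fin.elim0, fun i => i.elim0, ⟨h0.iso (by
      rw [IsZero.iff_id_eq_zero]
      ext j
      exact j.elim0)⟩⟩
  by_cases hT : Indecomposable T
  · refine ⟨1, fun _ => T, fun _ => hT, ⟨?_⟩⟩
    exact (LinearEquiv.funUnique (Fin 1) R T).symm.toModuleIso ≪≫
      (biproductIsoPi fun _ : Fin 1 => T).symm
  · unfold Indecomposable at hT
    push Not at hT
    obtain ⟨Y, Z, e, hY, hZ⟩ := hT h0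
    have hfY := finite_of_retract (⟨biprod.inl ≫ e.inv, e.hom ≫ biprod.fst, by simp⟩ : Retract Y T)
    have hfZ := finite_of_retract (⟨biprod.inr ≫ e.inv, e.hom ≫ biprod.snd, by simp⟩ : Retract Z T)
    have hl : moduleLength R T = moduleLength R Y + moduleLength R Z := by
      rw [← moduleLength_prod]
      exact LinearEquiv.moduleLength_eq R (e ≪≫ biprodIsoProd Y Z).toLinearEquiv
    have hYn : Nontrivial Y := not_subsingleton_iff_nontrivial.1
      fun hs => hY (isZero_of_subsingleton Y)
    have hZn : Nontrivial Z := not_subsingleton_iff_nontrivial.1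
      fun hs => hZ (isZero_of_subsingleton Z)
    have hYp := moduleLength_pos R (M := Y)
    have hZp := moduleLength_pos R (M := Z)
    obtain ⟨m, X, hX, ⟨f⟩⟩ := ih _ (by omega) Y rfl
    obtain ⟨n, X', hX', ⟨g⟩⟩ := ih _ (by omega) Z rfl
    obtain ⟨e'⟩ := exists_iso_biproduct_of_iso_biprod e f g
    refine ⟨m + n, _, fun i => ?_, ⟨e'⟩⟩
    rcases finSumFinEquiv.symm i with j | j
    · exact hX j
    · exact hX' j

end ModuleCat

/-! ### Separating simple modules by ring elements -/

section SimpleModules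

variable (K : Type*) [Field K] {R : Type*} [Ring R] [Algebra K R]

/-- For finitely many pairwise non-isomorphic simple modules, some ring element acts as the identity
on one of them and annihilates the others. -/
theorem exists_smul_eq_ite_of_isSimpleModule {ι : Type*} [Fintype ι] [DecidableEq ι]
    (S : ι → Type*) [∀ i, AddCommGroup (S i)] [∀ i, Module R (S i)] [∀ i, Module K (S i)]
    [∀ i, IsScalarTower K R (S i)] [∀ i, Module.Finite K (S i)] [∀ i, IsSimpleModule R (S i)]
    (hS : ∀ i j, Nonempty (S i ≃ₗ[R] S j) → i = j) (i : ι) :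
    ∃ a : R, ∀ j, ∀ x : S j, a • x = if j = i then x else 0 := by
  have hzero : ∀ j k, j ≠ k → ∀ f : S j →ₗ[R] S k, f = 0 := fun j k hjk f =>
    (LinearMap.bijective_or_eq_zero f).resolve_left fun hf =>
      hjk (hS j k ⟨LinearEquiv.ofBijective f hf⟩)
  let p : (∀ j, S j) →ₗ[R] (∀ j, S j) := LinearMap.single R S i ∘ₗ LinearMap.proj i
  -- By Schur, endomorphisms of the product are diagonal, so they commute with the projection to `S
  -- i`; density then realises `p` by a ring element on a finite `K`-spanning set.
  have hcomm : ∀ (φ : Module.End R (∀ j, S j)) (x : ∀ j, S j), p (φ x) = φ (p x) := by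
    intro φ x
    have hx : φ x = ∑ j, φ (Pi.single j (x j)) := by
      rw [← map_sum, Finset.univ_sum_single]
    have hφ : ∀ j k, j ≠ k → ∀ y : S j, (φ (Pi.single j y)) k = 0 := fun j k hjk y =>
      LinearMap.congr_fun (hzero j k hjk (LinearMap.proj k ∘ₗ φ ∘ₗ LinearMap.single R S j)) y
    have h1 : (φ x) i = (φ (Pi.single i (x i))) i := by
      rw [hx, Finset.sum_apply]
      exact Finset.sum_eq_single_of_mem i (Finset.mem_univ i) fun j _ hj => hφ j i hj _
    ext k
    change (Pi.single i ((φ x) i) : ∀ j, S j) k = (φ (Pi.single i (x i))) k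
    by_cases hk : k = i
    · subst hk
      rw [Pi.single_eq_same, h1]
    · rw [Pi.single_eq_of_ne hk, hφ i k (Ne.symm hk)]
  let f : Module.End (Module.End R (∀ j, S j)) (∀ j, S j) :=
    { toFun := p
      map_add' := p.map_add
      map_smul' := hcomm }
  obtain ⟨s, hs⟩ := Module.Finite.fg_top (R := K) (M := ∀ j, S j)
  obtain ⟨a, ha⟩ := jacobson_density f s
  have key : ∀ x : ∀ j, S j, p x = a • x := by
    intro x
    have hx : x ∈ Submodule.span K (s : Set (∀ j, S j)) := hs ▸ Submodule.mem_top
    induction hx using Submodule.span_induction with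
    | mem x hx => exact ha x hx
    | zero => simp
    | add x y _ _ hx hy => rw [map_add, hx, hy, smul_add]
    | smul c x _ hx =>
      rw [← algebraMap_smul R c x, map_smul, hx, smul_smul, smul_smul, Algebra.commutes]
  refine ⟨a, fun j x => ?_⟩
  have h := congrFun (key (Pi.single j x)) j
  rw [Pi.smul_apply, Pi.single_eq_same] at h
  rw [← h]
  change (Pi.single i ((Pi.single j x : ∀ j, S j) i) : ∀ j, S j) j = _
  split_ifs with hj
  · subst hj
    simp
  · simp [Pi.single_eq_of_ne hj]

theorem card_le_finrank_of_isSimpleModule [FiniteDimensional K R] {ι : Type*} [Fintype ι]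
    (S : ι → Type*) [∀ i, AddCommGroup (S i)] [∀ i, Module R (S i)] [∀ i, Module K (S i)]
    [∀ i, IsScalarTower K R (S i)] [∀ i, Module.Finite K (S i)] [∀ i, IsSimpleModule R (S i)]
    (hS : ∀ i j, Nonempty (S i ≃ₗ[R] S j) → i = j) : Fintype.card ι ≤ Module.finrank K R := by
  classical
  choose a ha using exists_smul_eq_ite_of_isSimpleModule K S hS
  refine LinearIndependent.fintype_card_le_finrank (b := a) ?_
  rw [Fintype.linearIndependent_iff]
  intro c hc j
  have := IsSimpleModule.nontrivial R (S j)
  obtain ⟨x, hx⟩ := exists_ne (0 : S j)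
  have h : (∑ i, c i • a i) • x = 0 := by rw [hc, zero_smul]
  simp only [Finset.sum_smul, smul_assoc, ha] at h
  have h' : c j • x = 0 := by simpa using h
  exact (smul_eq_zero.1 h').resolve_right hx

/-- If the finitely many simple modules below represent all isomorphism classes, then the element
acting as the identity on one of them and annihilating the others may be chosen idempotent. -/
theorem exists_isIdempotentElem_smul_eq_ite [IsArtinianRing R] {ι : Type*} [Fintype ι]
    [DecidableEq ι]
    (S : ι → Type*) [∀ i, AddCommGroup (S i)] [∀ i, Module R (S i)] [∀ i, Module K (S i)]
    [∀ i, IsScalarTower K R (S i)] [∀ i, Module.Finite K (S i)] [∀ i, IsSimpleModule R (S i)]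
    (hS : ∀ i j, Nonempty (S i ≃ₗ[R] S j) → i = j)
    (hall : ∀ m : Submodule R R, IsCoatom m → ∃ i, Nonempty ((R ⧸ m) ≃ₗ[R] S i)) (i : ι) :
    ∃ e : R, IsIdempotentElem e ∧ ∀ j, ∀ x : S j, e • x = if j = i then x else 0 := by
  obtain ⟨a, ha⟩ := exists_smul_eq_ite_of_isSimpleModule K S hS i
  -- `a` is idempotent on every simple quotient of `R`, hence modulo the radical; nilpotency of the
  -- radical lets it be lifted.
  have hrad : a - a ^ 2 ∈ Ring.jacobson R := by
    refine (Submodule.mem_sInf).2 fun m hm => ?_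
    obtain ⟨j, ⟨φ⟩⟩ := hall m hm
    have h0 : (a - a ^ 2) • (m.mkQ 1) = 0 := by
      apply φ.injective
      rw [map_smul, map_zero, sub_smul, pow_two, mul_smul, ha, ha]
      split_ifs <;> simp [*]
    rw [← map_smul, smul_eq_mul, mul_one] at h0
    exact (Submodule.Quotient.mk_eq_zero m).1 h0
  obtain ⟨n, hn⟩ := IsSemiprimaryRing.isNilpotent (R := R)
  -- The positive exponent ensures that the powers of `a` and of `1 - a ^ (n + 1)` still kill what
  -- these elements kill.
  have hn' : (a - a ^ 2) ^ (n + 1) = 0 := by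
    have := Ideal.pow_mem_pow hrad n
    rw [hn] at this
    rw [pow_succ, (by simpa using this : (a - a ^ 2) ^ n = 0), zero_mul]
  refine ⟨_, isIdempotentElem_one_sub_one_sub_pow_pow a (n + 1) hn', fun j x => ?_⟩
  have hfix : ∀ (b : R) (x : S j) (k : ℕ), b • x = x → b ^ k • x = x := fun b x k hb => by
    induction k with
    | zero => simp
    | succ k ih => rw [pow_succ, mul_smul, hb, ih]
  have haj := ha j x
  split_ifs at haj ⊢
  · rw [sub_smul, one_smul, pow_succ (1 - a ^ (n + 1)), mul_smul, sub_smul 1, one_smul,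
      hfix a x _ haj, sub_self, smul_zero, sub_zero]
  · have h0 : (1 - a ^ (n + 1)) • x = x := by
      rw [sub_smul, one_smul, pow_succ, mul_smul, haj, smul_zero, sub_zero]
    rw [sub_smul, one_smul, hfix _ x _ h0, sub_self]

end SimpleModules

/-! ### Additivity of `dim eM` -/

section IdempotentRank

variable (K : Type*) [Field K] {R : Type*} [Ring R] [Algebra K R]

/-- The `K`-dimension of `e M`. -/
noncomputable def smulRank (e : R) (M : Type*) [AddCommGroup M] [Module R M] [Module K M]
    [IsScalarTower K R M] : ℕ :=
  moduleLength K (LinearMap.range (Algebra.lsmul K K M e))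

variable {M₁ M₂ M₃ : Type*} [AddCommGroup M₁] [Module R M₁] [Module K M₁] [IsScalarTower K R M₁]
  [AddCommGroup M₂] [Module R M₂] [Module K M₂] [IsScalarTower K R M₂]
  [AddCommGroup M₃] [Module R M₃] [Module K M₃] [IsScalarTower K R M₃]
  [Module.Finite K M₁] [Module.Finite K M₃]

theorem smulRank_eq_add_of_exact {e : R} (he : IsIdempotentElem e) (f : M₁ →ₗ[R] M₂)
    (g : M₂ →ₗ[R] M₃) (hf : Function.Injective f) (hg : Function.Surjective g)
    (hfg : Function.Exact f g) : smulRank K e M₂ = smulRank K e M₁ + smulRank K e M₃ := by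
  let f' : LinearMap.range (Algebra.lsmul K K M₁ e) →ₗ[K] LinearMap.range (Algebra.lsmul K K M₂ e) :=
    (f.restrictScalars K).restrict (by rintro _ ⟨x, rfl⟩; exact ⟨f x, by simp⟩)
  let g' : LinearMap.range (Algebra.lsmul K K M₂ e) →ₗ[K] LinearMap.range (Algebra.lsmul K K M₃ e) :=
    (g.restrictScalars K).restrict (by rintro _ ⟨x, rfl⟩; exact ⟨g x, by simp⟩)
  have hf' : Function.Injective f' := fun x y h => Subtype.ext (hf (congrArg Subtype.val h))
  have hg' : Function.Surjective g' := by
    rintro ⟨_, x, rfl⟩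
    obtain ⟨y, rfl⟩ := hg x
    exact ⟨⟨_, y, rfl⟩, Subtype.ext (map_smul g e y)⟩
  have hex : Function.Exact f' g' := by
    rintro ⟨_, y, rfl⟩
    constructor
    · intro h
      obtain ⟨x, hx⟩ := (hfg _).1 (congrArg Subtype.val h)
      -- Here idempotency enters: if `f x = e y`, then `f (e x) = e (e y) = e y`.
      refine ⟨⟨e • x, x, rfl⟩, Subtype.ext ?_⟩
      change f (e • x) = e • y
      rw [map_smul, hx]
      change e • e • y = e • y
      rw [smul_smul, he]
    · rintro ⟨x, hx⟩
      rw [← hx]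
      exact Subtype.ext (hfg.apply_apply_eq_zero x.1)
  rw [smulRank, moduleLength, Module.length_eq_add_of_exact f' g' hf' hg' hex,
    ENat.toNat_add Module.length_ne_top Module.length_ne_top]
  rfl

end IdempotentRank

/-! ### The Grothendieck group and its basis of simples -/

namespace RightMod

section Grothendieck

variable {A : Type u} [Ring A]

/-- The class of a finitely generated module in the Grothendieck group. -/
def grothendieckClass (M : RightMod A) (hM : Module.Finite Aᵐᵒᵖ M) : GrothendieckGroup A :=
  QuotientAddGroup.mk (FreeAbelianGroup.of ⟨M, hM⟩)

theorem grothendieckClass_eq_add {M₁ M₂ M₃ : RightMod A} {h₁ : Module.Finite Aᵐᵒᵖ M₁}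
    {h₂ : Module.Finite Aᵐᵒᵖ M₂} {h₃ : Module.Finite Aᵐᵒᵖ M₃} (f : M₁ →ₗ[Aᵐᵒᵖ] M₂)
    (g : M₂ →ₗ[Aᵐᵒᵖ] M₃) (hf : Function.Injective f) (hg : Function.Surjective g)
    (hfg : Function.Exact f g) :
    grothendieckClass M₂ h₂ = grothendieckClass M₁ h₁ + grothendieckClass M₃ h₃ := by
  have hmem : FreeAbelianGroup.of (⟨M₂, h₂⟩ : FGMod A) - FreeAbelianGroup.of ⟨M₁, h₁⟩ -
      FreeAbelianGroup.of ⟨M₃, h₃⟩ ∈ AddSubgroup.closure (grothendieckRelations A) :=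
    AddSubgroup.subset_closure ⟨⟨M₁, h₁⟩, ⟨M₂, h₂⟩, ⟨M₃, h₃⟩, ModuleCat.ofHom f,
      ModuleCat.ofHom g, by ext x; exact hfg.apply_apply_eq_zero x,
      ModuleCat.shortComplex_shortExact _ hfg hf hg, rfl⟩
  have h0 := (QuotientAddGroup.eq_zero_iff _).2 hmem
  rw [sub_sub, QuotientAddGroup.mk_sub, sub_eq_zero] at h0
  exact h0

theorem grothendieckClass_eq_zero {M : RightMod A} {hM : Module.Finite Aᵐᵒᵖ M} [Subsingleton M] :
    grothendieckClass M hM = 0 := by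
  have h := grothendieckClass_eq_add (h₁ := hM) (h₂ := hM) (h₃ := hM) (0 : M →ₗ[Aᵐᵒᵖ] M)
    (0 : M →ₗ[Aᵐᵒᵖ] M) (fun _ _ _ => Subsingleton.elim _ _) (fun x => ⟨x, Subsingleton.elim _ _⟩)
    (fun x => ⟨fun _ => ⟨x, Subsingleton.elim _ _⟩, fun _ => rfl⟩)
  simpa using h

/-- The generators are modules, not isomorphism classes, so invariance comes from the relation for
`0 → M → N → 0 → 0`. -/
theorem grothendieckClass_congr {M N : RightMod A} (hM : Module.Finite Aᵐᵒᵖ M)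
    (hN : Module.Finite Aᵐᵒᵖ N) (e : M ≃ₗ[Aᵐᵒᵖ] N) :
    grothendieckClass M hM = grothendieckClass N hN := by
  have h := grothendieckClass_eq_add (M₁ := M) (M₂ := N) (M₃ := ModuleCat.of Aᵐᵒᵖ PUnit)
    (h₁ := hM) (h₂ := hN) (h₃ := inferInstance) e.toLinearMap 0 e.injective
    (fun x => ⟨0, Subsingleton.elim _ _⟩)
    (fun x => ⟨fun _ => ⟨e.symm x, e.apply_symm_apply x⟩, fun _ => rfl⟩)
  have : Subsingleton (ModuleCat.of Aᵐᵒᵖ PUnit.{u + 1}) := inferInstanceAs (Subsingleton PUnit)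
  rw [h, grothendieckClass_eq_zero (M := ModuleCat.of Aᵐᵒᵖ PUnit), add_zero]

/-- A subgroup of the Grothendieck group that contains the classes of simple modules is everything
when `A` is artinian. -/
theorem grothendieckClass_mem_of_isSimpleModule [IsArtinianRing Aᵐᵒᵖ]
    (H : AddSubgroup (GrothendieckGroup A))
    (hH : ∀ (S : RightMod A) (hS : Module.Finite Aᵐᵒᵖ S), IsSimpleModule Aᵐᵒᵖ S →
      grothendieckClass S hS ∈ H)
    (M : RightMod A) (hM : Module.Finite Aᵐᵒᵖ M) : grothendieckClass M hM ∈ H := by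
  induction hd : moduleLength Aᵐᵒᵖ M using Nat.strong_induction_on generalizing M with
  | _ d ih =>
  subst hd
  rcases subsingleton_or_nontrivial M with hs | hn
  · rw [grothendieckClass_eq_zero]
    exact H.zero_mem
  obtain ⟨N, hN⟩ := IsAtomic.exists_atom (Submodule Aᵐᵒᵖ M)
  have hNs : IsSimpleModule Aᵐᵒᵖ N := isSimpleModule_iff_isAtom.2 hN
  have hlt : moduleLength Aᵐᵒᵖ (M ⧸ N) < moduleLength Aᵐᵒᵖ M :=
    moduleLength_lt_of_surjective N.mkQ_surjective fun h => hN.1 (by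
      rw [← N.ker_mkQ, LinearMap.ker_eq_bot.2 h])
  rw [grothendieckClass_eq_add (M₁ := ModuleCat.of Aᵐᵒᵖ N) (M₃ := ModuleCat.of Aᵐᵒᵖ (M ⧸ N))
    (h₁ := inferInstanceAs (Module.Finite Aᵐᵒᵖ N))
    (h₃ := inferInstanceAs (Module.Finite Aᵐᵒᵖ (M ⧸ N)))
    N.subtype N.mkQ N.injective_subtype N.mkQ_surjective (LinearMap.exact_subtype_mkQ N)]
  exact H.add_mem (hH (ModuleCat.of Aᵐᵒᵖ N) _ hNs) (ih _ hlt (ModuleCat.of Aᵐᵒᵖ (M ⧸ N)) _ rfl)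

open scoped ModuleCat

theorem finite_of_finite_mulOpposite (K : Type*) [Field K] [Algebra K A] [FiniteDimensional K A]
    (M : RightMod A) [Module.Finite Aᵐᵒᵖ M] :
    Module.Finite K M :=
  Module.Finite.trans Aᵐᵒᵖ M

/-- The additive function on the Grothendieck group given by `M ↦ dim e M`. -/
theorem exists_addMonoidHom_eq_smulRank (K : Type*) [Field K] [Algebra K A] [FiniteDimensional K A]
    {e : Aᵐᵒᵖ} (he : IsIdempotentElem e) :
    ∃ φ : GrothendieckGroup A →+ ℤ, ∀ (M : RightMod A) (hM : Module.Finite Aᵐᵒᵖ M),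
      φ (grothendieckClass M hM) = smulRank K e M := by
  refine ⟨QuotientAddGroup.lift _ (FreeAbelianGroup.lift fun M : FGMod A => (smulRank K e M.1 : ℤ))
    ?_, fun M hM => ?_⟩
  · rw [AddSubgroup.closure_le]
    rintro _ ⟨M₁, M₂, M₃, f, g, w, hS, rfl⟩
    have := M₁.2
    have := M₃.2
    have := finite_of_finite_mulOpposite K M₁.1
    have := finite_of_finite_mulOpposite K M₃.1
    have h := smulRank_eq_add_of_exact K he f.hom g.hom hS.moduleCat_injective_f
      hS.moduleCat_surjective_g ((ShortComplex.ShortExact.moduleCat_exact_iff_function_exact _).1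
        hS.exact)
    simp [h]
  · simp [grothendieckClass]

theorem isSimpleModule_out {c : Quotient (isIsomorphicSetoid (RightMod A))}
    (hc : c ∈ isoClasses fun S : RightMod A => IsSimpleModule Aᵐᵒᵖ S) :
    IsSimpleModule Aᵐᵒᵖ c.out := by
  obtain ⟨M, hM, rfl⟩ := hc
  obtain ⟨e⟩ := Quotient.mk_out (s := isIsomorphicSetoid (RightMod A)) M
  exact IsSimpleModule.congr e.toLinearEquiv

theorem eq_of_out_linearEquiv {c d : Quotient (isIsomorphicSetoid (RightMod A))}
    (e : c.out ≃ₗ[Aᵐᵒᵖ] d.out) : c = d :=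
  Quotient.out_equiv_out.1 ⟨e.toModuleIso⟩

theorem finite_isoClasses_isSimpleModule (K : Type*) [Field K] [Algebra K A] [FiniteDimensional K A] :
    (isoClasses fun S : RightMod A => IsSimpleModule Aᵐᵒᵖ S).Finite := by
  by_contra hinf
  obtain ⟨t, ht, hcard⟩ := Set.Infinite.exists_subset_card_eq hinf (Module.finrank K Aᵐᵒᵖ + 1)
  have : ∀ c : t, IsSimpleModule Aᵐᵒᵖ c.1.out := fun c => isSimpleModule_out (ht c.2)
  have : ∀ c : t, Module.Finite K c.1.out := fun c => finite_of_finite_mulOpposite K _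
  have := card_le_finrank_of_isSimpleModule K (R := Aᵐᵒᵖ) (fun c : t => c.1.out)
    fun c d ⟨e⟩ => Subtype.ext (eq_of_out_linearEquiv e)
  rw [Fintype.card_coe] at this
  omega

/-- The rank of the Grothendieck group is the number of simple modules. -/
theorem encard_isoClasses_isSimpleModule (K : Type*) [Field K] [Algebra K A] [FiniteDimensional K A] :
    (isoClasses fun S : RightMod A => IsSimpleModule Aᵐᵒᵖ S).encard =
      (Module.finrank ℤ (GrothendieckGroup A) : ℕ∞) := by
  classical
  set 𝒮 := isoClasses fun S : RightMod A => IsSimpleModule Aᵐᵒᵖ S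
  have hfin : 𝒮.Finite := finite_isoClasses_isSimpleModule K
  have : Fintype 𝒮 := hfin.fintype
  have hR : IsArtinianRing Aᵐᵒᵖ := IsArtinianRing.of_finite K Aᵐᵒᵖ
  have hsimple : ∀ c : 𝒮, IsSimpleModule Aᵐᵒᵖ c.1.out := fun c => isSimpleModule_out c.2
  have hfinite : ∀ c : 𝒮, Module.Finite Aᵐᵒᵖ c.1.out := fun c => inferInstance
  have : ∀ c : 𝒮, Module.Finite K c.1.out := fun c => finite_of_finite_mulOpposite K _
  let b (c : 𝒮) : GrothendieckGroup A := grothendieckClass c.1.out (hfinite c)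
  have hspan : ⊤ ≤ Submodule.span ℤ (Set.range b) := by
    intro x _
    obtain ⟨y, rfl⟩ := QuotientAddGroup.mk_surjective x
    have hclass : ∀ M : FGMod A, grothendieckClass M.1 M.2 ∈
        (Submodule.span ℤ (Set.range b)).toAddSubgroup := fun M => by
      refine grothendieckClass_mem_of_isSimpleModule _ (fun S hS hs => ?_) _ _
      obtain ⟨e⟩ := Quotient.mk_out (s := isIsomorphicSetoid (RightMod A)) S
      rw [← grothendieckClass_congr (hfinite ⟨Quotient.mk _ S, S, hs, rfl⟩) hS e.toLinearEquiv]
      exact Submodule.subset_span ⟨⟨Quotient.mk _ S, S, hs, rfl⟩, rfl⟩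
    induction y using FreeAbelianGroup.induction_on with
    | zero => exact Submodule.zero_mem _
    | of M => exact hclass M
    | neg M h => exact Submodule.neg_mem _ (hclass M)
    | add y z hy hz => exact Submodule.add_mem _ (hy trivial) (hz trivial)
  have hind : LinearIndependent ℤ b := by
    rw [Fintype.linearIndependent_iff]
    intro n hn c
    obtain ⟨e, he, hec⟩ := exists_isIdempotentElem_smul_eq_ite K (R := Aᵐᵒᵖ)
      (fun c : 𝒮 => c.1.out) (fun c d ⟨e⟩ => Subtype.ext (eq_of_out_linearEquiv e))
      (fun m hm => by
        have hs : IsSimpleModule Aᵐᵒᵖ (Aᵐᵒᵖ ⧸ m) := isSimpleModule_iff_isCoatom.2 hm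
        obtain ⟨φ⟩ := Quotient.mk_out (s := isIsomorphicSetoid (RightMod A))
          (ModuleCat.of Aᵐᵒᵖ (Aᵐᵒᵖ ⧸ m))
        exact ⟨⟨Quotient.mk _ _, _, hs, rfl⟩, ⟨φ.symm.toLinearEquiv⟩⟩) c
    -- `φ` vanishes on every simple class except that of `c`, so it isolates the coefficient `n c`.
    obtain ⟨φ, hφ⟩ := exists_addMonoidHom_eq_smulRank K he
    have hne : ∀ d, d ≠ c → φ (b d) = 0 := fun d hd => by
      rw [hφ, Nat.cast_eq_zero, smulRank]
      have : Subsingleton (LinearMap.range (Algebra.lsmul K K d.1.out e)) := by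
        rw [Submodule.subsingleton_iff_eq_bot, LinearMap.range_eq_bot]
        ext x
        simpa [hd] using hec d x
      rw [moduleLength, Module.length_eq_zero]
      rfl
    have hc : φ (b c) ≠ 0 := by
      rw [hφ, Nat.cast_ne_zero, smulRank]
      have hr : LinearMap.range (Algebra.lsmul K K c.1.out e) = ⊤ :=
        LinearMap.range_eq_top.2 fun x => ⟨x, by simpa using hec c x⟩
      have : Nontrivial c.1.out := IsSimpleModule.nontrivial Aᵐᵒᵖ _
      have : Nontrivial (LinearMap.range (Algebra.lsmul K K c.1.out e)) := by
        rw [Submodule.nontrivial_iff_ne_bot, hr]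
        exact top_ne_bot
      exact (moduleLength_pos K).ne'
    have h := congrArg φ hn
    rw [map_sum, map_zero, Finset.sum_eq_single_of_mem c (Finset.mem_univ c)
      (fun d _ hd => by rw [map_zsmul, hne d hd, smul_zero]), map_zsmul] at h
    exact (smul_eq_zero.1 h).resolve_right hc
  rw [Module.finrank_eq_nat_card_basis (Module.Basis.mk hind hspan), Nat.card_coe_set_eq,
    hfin.cast_ncard_eq]

end Grothendieck

end RightMod

/-! ### Ordering by the direction of nonzero maps -/

section Ordering

variable {R : Type*} [Ring R]

/-- If nonzero maps between pairwise non-isomorphic modules are injective or surjective, then the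
modules can be ordered so that there are no nonzero maps backwards. -/
theorem exists_perm_hom_eq_zero {n : ℕ} (X : Fin n → Type*) [∀ i, AddCommGroup (X i)]
    [∀ i, Module R (X i)] [∀ i, IsArtinian R (X i)] [∀ i, IsNoetherian R (X i)]
    [∀ i, Nontrivial (X i)] (hX : ∀ i j, Nonempty (X i ≃ₗ[R] X j) → i = j)
    (h : ∀ i j (f : X i →ₗ[R] X j), f ≠ 0 → Function.Injective f ∨ Function.Surjective f) :
    ∃ σ : Equiv.Perm (Fin n), ∀ i j, i < j → ∀ f : X (σ j) →ₗ[R] X (σ i), f = 0 := by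
  classical
  have hbij : ∀ i j, i ≠ j → ∀ f : X i →ₗ[R] X j, ¬ (Function.Injective f ∧ Function.Surjective f) :=
    fun i j hij f hf => hij (hX i j ⟨LinearEquiv.ofBijective f hf⟩)
  -- the targets of proper surjections
  let Q (i : Fin n) : Prop := ∃ j, j ≠ i ∧ ∃ f : X j →ₗ[R] X i, Function.Surjective f
  have hQ : ∀ i j, Q i → i ≠ j → ∀ f : X i →ₗ[R] X j, ¬ Function.Injective f := by
    rintro i j ⟨k, hk, g, hg⟩ hij f hf
    have hfg : f ∘ₗ g ≠ 0 := fun h0 => by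
      obtain ⟨x, hx⟩ := exists_ne (0 : X i)
      obtain ⟨y, rfl⟩ := hg x
      exact hx (hf (by simpa using LinearMap.congr_fun h0 y))
    rcases h k j _ hfg with h1 | h1
    · exact hbij k i hk g ⟨Function.Injective.of_comp (f := f) h1, hg⟩
    · exact hbij i j hij f ⟨hf, Function.Surjective.of_comp (g := g) h1⟩
  let l (i : Fin n) : ℕ := moduleLength R (X i)
  -- A rank that nonzero maps between distinct modules raise. With `L = ∑ j, l j`, values outside
  -- `Q` are at most `L` and grow with length; values in `Q` are at least `L + 1` and grow as length
  -- drops. Injections start outside `Q`, surjections end in `Q`.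
  let r (i : Fin n) : ℕ := if Q i then 2 * ∑ j, l j + 1 - l i else l i
  have hl : ∀ i, l i ≤ ∑ j, l j := fun i =>
    Finset.single_le_sum (f := l) (fun _ _ => Nat.zero_le _) (Finset.mem_univ i)
  have hr : ∀ i j, i ≠ j → ∀ f : X i →ₗ[R] X j, f ≠ 0 → r i < r j := by
    intro i j hij f hf
    have hi := hl i
    have hj := hl j
    by_cases hinj : Function.Injective f
    · have hsurj : ¬ Function.Surjective f := fun hs => hbij i j hij f ⟨hinj, hs⟩
      have hlt : l i < l j := moduleLength_lt_of_injective hinj hsurj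
      have hQi : ¬ Q i := fun hq => hQ i j hq hij f hinj
      simp only [r, if_neg hQi]
      split_ifs <;> omega
    · have hsurj := (h i j f hf).resolve_left hinj
      have hlt : l j < l i := moduleLength_lt_of_surjective hsurj hinj
      have hQj : Q j := ⟨i, hij, f, hsurj⟩
      simp only [r, if_pos hQj]
      split_ifs <;> omega
  refine ⟨Tuple.sort r, fun i j hij f => ?_⟩
  by_contra hf
  have h1 := hr _ _ (fun h0 => hij.ne' ((Tuple.sort r).injective h0)) f hf
  have h2 := Tuple.monotone_sort r hij.le
  exact absurd h1 (not_lt.2 h2)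

end Ordering

/-! ### Application to tilting modules -/

namespace RightMod

variable {A : Type u} [Ring A]

theorem IsHereditary.submodulesProjective (hA : IsHereditary A) (n : ℕ) :
    SubmodulesProjective Aᵐᵒᵖ (Fin n → A) :=
  SubmodulesProjective.pi_fin hA n

/-- Heredity concerns submodules of `A`, so the free cover must be a power of `A` rather than of
`Aᵐᵒᵖ`. -/
theorem exists_surjective_pi (M : RightMod A) [Module.Finite Aᵐᵒᵖ M] :
    ∃ (n : ℕ) (p : (Fin n → A) →ₗ[Aᵐᵒᵖ] M), Function.Surjective p := by
  obtain ⟨n, p, hp⟩ := Module.Finite.exists_fin' Aᵐᵒᵖ M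
  let e : A ≃ₗ[Aᵐᵒᵖ] Aᵐᵒᵖ :=
    { MulOpposite.opAddEquiv with
      map_smul' := fun _ _ => rfl }
  exact ⟨n, p ∘ₗ (LinearEquiv.piCongrRight fun _ : Fin n => e).toLinearMap,
    hp.comp (LinearEquiv.surjective _)⟩

theorem IsHereditary.injective_or_surjective [IsArtinianRing Aᵐᵒᵖ] (hA : IsHereditary A)
    {X Y : RightMod A} [Module.Finite Aᵐᵒᵖ X] [Module.Finite Aᵐᵒᵖ Y] (hX : Indecomposable X)
    (hY : Indecomposable Y) (h : ExtOneVanishes Y X) (f : X →ₗ[Aᵐᵒᵖ] Y) (hf : f ≠ 0) :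
    Function.Injective f ∨ Function.Surjective f := by
  obtain ⟨n, p, hp⟩ := exists_surjective_pi Y
  exact injective_or_surjective_of_extensionsSplit (ModuleCat.isIndecomposableModule hX)
    (ModuleCat.isIndecomposableModule hY) (hA.submodulesProjective n) p hp
    (ModuleCat.extensionsSplit h) f hf

theorem isSummand_iff_nonempty_retract {M T : RightMod A} :
    IsSummand M T ↔ Nonempty (Retract M T) := by
  refine ⟨?_, fun ⟨r⟩ => ModuleCat.exists_iso_biprod_of_retract r⟩
  rintro ⟨N, ⟨e⟩⟩
  exact ⟨⟨biprod.inl ≫ e.inv, e.hom ≫ biprod.fst, by simp⟩⟩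

/-- Isomorphic summands at distinct positions would make `X i ⊞ X i` a retract of `T`. -/
theorem eq_of_iso_of_multiplicity_free {T : RightMod A}
    (hT : ∀ M : RightMod A, Indecomposable M → ¬ IsSummand (M ⊞ M) T) {n : ℕ}
    {X : Fin n → RightMod A} (hX : ∀ i, Indecomposable (X i)) (e : T ≅ ⨁ X) {i j : Fin n}
    (φ : X i ≅ X j) : i = j := by
  by_contra hij
  refine hT (X i) (hX i) (isSummand_iff_nonempty_retract.2
    ⟨⟨biprod.desc (biproduct.ι X i) (φ.hom ≫ biproduct.ι X j) ≫ e.inv,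
      e.hom ≫ biprod.lift (biproduct.π X i) (biproduct.π X j ≫ φ.inv), ?_⟩⟩)
  rw [Category.assoc, e.inv_hom_id_assoc]
  apply biprod.hom_ext' <;> apply biprod.hom_ext <;>
    simp [hij, Ne.symm hij]

theorem encard_isoClasses_summand [IsArtinianRing Aᵐᵒᵖ] {T : RightMod A} [Module.Finite Aᵐᵒᵖ T]
    (hT : ∀ M : RightMod A, Indecomposable M → ¬ IsSummand (M ⊞ M) T) {n : ℕ}
    {X : Fin n → RightMod A} (hX : ∀ i, Indecomposable (X i)) (e : T ≅ ⨁ X) :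
    (isoClasses fun M : RightMod A => Indecomposable M ∧ IsSummand M T).encard = n := by
  let q (i : Fin n) : Quotient (isIsomorphicSetoid (RightMod A)) := Quotient.mk _ (X i)
  have hq : Function.Injective q := fun i j hij => by
    obtain ⟨φ⟩ := Quotient.exact hij
    exact eq_of_iso_of_multiplicity_free hT hX e φ
  have hrange : (isoClasses fun M : RightMod A => Indecomposable M ∧ IsSummand M T) =
      Set.range q := by
    ext c
    constructor
    · rintro ⟨M, ⟨hM, hMT⟩, rfl⟩
      obtain ⟨r⟩ := isSummand_iff_nonempty_retract.1 hMT
      obtain ⟨i, ⟨φ⟩⟩ := ModuleCat.exists_iso_of_retract_biproduct hX hM e r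
      exact ⟨i, Quotient.sound ⟨φ.symm⟩⟩
    · rintro ⟨i, rfl⟩
      exact ⟨X i, ⟨hX i, isSummand_iff_nonempty_retract.2
        ⟨ModuleCat.retractOfIsoBiproduct e i⟩⟩, rfl⟩
  rw [hrange, ← Set.image_univ, hq.encard_image, Set.encard_univ]
  simp

end RightMod

theorem mainTheorem8 (K : Type*) [Field K] [IsAlgClosed K]
    (A : Type u) [Ring A] [Algebra K A] [FiniteDimensional K A]
    (hA : RightMod.IsHereditary A)
    (T : RightMod A) (hT : RightMod.IsBasicTilting T) :
    (∃ (n : ℕ) (X : Fin n → RightMod A),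
      (∀ i, Indecomposable (X i)) ∧ Nonempty (T ≅ ⨁ X)) ∧
    ∀ (n : ℕ) (X : Fin n → RightMod A),
      (∀ i, Indecomposable (X i)) → Nonempty (T ≅ ⨁ X) →
        ∃ σ : Equiv.Perm (Fin n),
          RightMod.IsCompleteStratifyingSystem fun i => X (σ i) := by
  have hR : IsArtinianRing Aᵐᵒᵖ := IsArtinianRing.of_finite K Aᵐᵒᵖ
  have hfin : Module.Finite Aᵐᵒᵖ T := hT.isTilting.finite
  refine ⟨ModuleCat.exists_iso_biproduct_indecomposable T, ?_⟩
  rintro n X hX ⟨e⟩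
  have hret := ModuleCat.retractOfIsoBiproduct e
  have hXfin : ∀ i, Module.Finite Aᵐᵒᵖ (X i) := fun i => ModuleCat.finite_of_retract (hret i)
  have hext : ∀ i j, RightMod.ExtOneVanishes (X i) (X j) := fun i j =>
    Abelian.Ext.subsingleton_of_retract hT.isTilting.ext_self (hret i) (hret j)
  have hnt : ∀ i, Nontrivial (X i) := fun i => (ModuleCat.isIndecomposableModule (hX i)).1
  obtain ⟨σ, hσ⟩ := exists_perm_hom_eq_zero (R := Aᵐᵒᵖ) (fun i => X i)
    (fun i j ⟨φ⟩ => RightMod.eq_of_iso_of_multiplicity_free hT.multiplicity_free hX e φ.toModuleIso)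
    (fun i j f hf => hA.injective_or_surjective (hX i) (hX j) (hext j i) f hf)
  refine ⟨σ, ⟨fun i => hXfin _, fun i => hX _, fun i j hij f => ?_, fun i j _ => hext _ _⟩, ?_⟩
  · exact ModuleCat.hom_ext (hσ i j hij f.hom)
  -- Simples and summand classes are both counted by the rank of `K₀(A)`; the latter number `n` by
  -- Krull–Schmidt.
  · rw [RightMod.encard_isoClasses_isSimpleModule K, ← hT.card_summands,
      RightMod.encard_isoClasses_summand hT.multiplicity_free hX e]
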